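/- Let $\Sigma$ be a finite set of edge labels. Bags are finite multisets. Regular bag expressions (RBEs) over an alphabet $\Delta$ are $E ::= \epsilon \mid a \mid E^* \mid (E\,|\,E) \mid (E \,\|\, E)$ with $a\in\Delta$, where $|$ is union, $\|$ is bag union of one element of each language, and $*$ is its iteration; a bag language is RBE-definable if it is the language of some RBE. A graph $G=(V,E)$ has a finite node set $V$ and edges $E\subseteq V\times\Sigma\times V$. A schema $S=(\Sigma,\Gamma,\delta)$ consists of a finite set $\Gamma$ of types and a function $\delta$ that maps every type to a bag language over $\Sigma\times\Gamma$; it is a shape expression schema (ShEx) if every $\delta(t)$ is RBE-definable. $L_s(S)$ is the set of graphs for which there is $\lambda:V\to\Gamma$ such that for every node $n$ the bag of all $(a,\lambda(m))$, one for each edge $(n,a,m)$, belongs to $\delta(\lambda(n))$. $L_m(S)$ is the set of graphs for which there is $\lambda:V\to 2^\Gamma$ with all $\lambda(n)$ nonempty such that for every node $n$ and every $t\in\lambda(n)$ one can choose for each edge $(n,a,m)$ a type in $\lambda(m)$ so that the resulting bag over $\Sigma\times\Gamma$ belongs to $\delta(t)$. Let $\mathrm{ShEx}_s$ and $\mathrm{ShEx}_m$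 be the classes of the graph languages $L_s(S)$, respectively $L_m(S)$, where $S$ ranges over the shape expression schemas over $\Sigma$. For bag languages $L_i$ over $A_0\times A_i$ ($1\le i\le k$), the distributing join $L_1\Join\dots\Join L_k$ is the set of bags $w$ over $A_0\times A_1\times\dots\times A_k$ whose image under the projection to $A_0\times A_i$ (with multiplicities added up) lies in $L_i$ for every $i$. The powerset schema $S^{\mathcal P}$ of $S$ has as types the nonempty subsets of $\Gamma$; for $T=\{t_1,\dots,t_k\}$, its $\delta^{\mathcal P}(T)$ is obtained from $\delta(t_1)\Join\dots\Join\delta(t_k)$ by replacing each occurrence of a symbol $(a,(s_1,\dots,s_k))$ by the disjunction of all $(a,T')$ with $\{s_1,\dots,s_k\}\subseteq T'\subseteq\Gamma$. For labels $a,b,c\in\Sigma$, the fork $G_\in$ has the nodes $0,\dots,4$ and the edges $(0,a,1),(0,b,2),(1,c,3),(2,c,4)$; the diamond $G_\diamond$ has the nodes $0,\dots,3$ and the edges $(0,a,1),(0,b,2),(1,c,3),(2,c,3)$. Theorem. 1. $L_m(S)=L_s(S^{\mathcal P})$ for every schema $S$ over $\Sigma$. 2. If $S$ is a shape expression schema,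 then every nonempty $\delta^{\mathcal P}(T)$ is RBE-definable. 3. $\mathrm{ShEx}_m\subseteq\mathrm{ShEx}_s$. 4. For all $a,b,c\in\Sigma$, some language in $\mathrm{ShEx}_s$ contains $G_\in$ but not $G_\diamond$, whereas every language in $\mathrm{ShEx}_m$ contains either both or neither of $G_\in$ and $G_\diamond$. 5. If $\Sigma\neq\emptyset$, then $\mathrm{ShEx}_m\subsetneq\mathrm{ShEx}_s$. -/

import Mathlib

namespace ShEx

/-! Bags are finite multisets; a bag language over `A` is a `Set (Multiset A)`. -/

/-- Unordered concatenation `L₁ ⊎ L₂` of bag languages. -/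
def concat {A : Type} (L₁ L₂ : Set (Multiset A)) : Set (Multiset A) :=
  {w | ∃ w₁ ∈ L₁, ∃ w₂ ∈ L₂, w = w₁ + w₂}

/-- The `i`-fold unordered concatenation of a bag language with itself. -/
def iter {A : Type} (L : Set (Multiset A)) : ℕ → Set (Multiset A)
  | 0 => {0}
  | i + 1 => concat L (iter L i)

/-- Regular bag expressions over the alphabet `A`:
`ε`, a symbol, star, disjunction, unordered concatenation. -/
inductive RBE (A : Type) : Type
  | eps : RBE A
  | sym : A → RBE A
  | star : RBE A → RBE A
  | alt : RBE A → RBE A → RBE A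
  | conc : RBE A → RBE A → RBE A

/-- The bag language of a regular bag expression. -/
def RBE.lang {A : Type} : RBE A → Set (Multiset A)
  | .eps => {0}
  | .sym a => {{a}}
  | .star E => ⋃ i : ℕ, iter E.lang i
  | .alt E₁ E₂ => E₁.lang ∪ E₂.lang
  | .conc E₁ E₂ => concat E₁.lang E₂.lang

/-- A bag language is regular if some regular bag expression defines it. -/
def IsRBE {A : Type} (L : Set (Multiset A)) : Prop := ∃ E : RBE A, E.lang = L

/-- Finite graphs with edges labeled by elements of `Lab`. -/
structure LGraph (Lab : Type) : Type 1 where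
  V : Type
  [finV : Finite V]
  edges : Finset (V × Lab × V)

open Classical in
/-- The labeled and typed out-neighbourhood of the node `n`: the bag of the `(a, lam m)`, one
occurrence for each edge `(n, a, m)`. It is used with `X` the set of types (single-type typings)
and with `X` the set of sets of types (multi-type typings). -/
noncomputable def LGraph.outLabType {Lab X : Type} (G : LGraph Lab) (lam : G.V → X) (n : G.V) :
    Multiset (Lab × X) :=
  (G.edges.filter (fun e => e.1 = n)).val.map (fun e => (e.2.1, lam e.2.2))

/-- A schema over the label set `Lab`: a finite set of types and a type definition function
that maps types to bag languages over `Lab × Ty`. -/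
structure Schema (Lab : Type) : Type 1 where
  Ty : Type
  [finTy : Finite Ty]
  δ : Ty → Set (Multiset (Lab × Ty))

/-- All type definitions are given by shape expressions, that is, by regular bag expressions. -/
def Schema.IsShEx {Lab : Type} (S : Schema Lab) : Prop := ∀ t : S.Ty, IsRBE (S.δ t)

/-- Valid single-type typings. -/
def Schema.ValidS {Lab : Type} (S : Schema Lab) (G : LGraph Lab) (lam : G.V → S.Ty) : Prop :=
  ∀ n : G.V, G.outLabType lam n ∈ S.δ (lam n)

/-- The flattenings of a bag over `Lab × Set Ty`: choose one type in every occurrence of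
every set. -/
def flattenings {Lab Ty : Type} (w : Multiset (Lab × Set Ty)) : Set (Multiset (Lab × Ty)) :=
  {u | Multiset.Rel (fun x y => y.1 = x.1 ∧ y.2 ∈ x.2) w u}

/-- Valid multi-type typings. -/
def Schema.ValidM {Lab : Type} (S : Schema Lab) (G : LGraph Lab) (lam : G.V → Set S.Ty) : Prop :=
  (∀ n : G.V, (lam n).Nonempty) ∧
    ∀ n : G.V, ∀ t ∈ lam n, (flattenings (G.outLabType lam n) ∩ S.δ t).Nonempty

/-- The graph language of a schema under the single-type semantics. -/
def Schema.Ls {Lab : Type} (S : Schema Lab) : Set (LGraph Lab) :=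
  {G | ∃ lam : G.V → S.Ty, S.ValidS G lam}

/-- The graph language of a schema under the multi-type semantics. -/
def Schema.Lm {Lab : Type} (S : Schema Lab) : Set (LGraph Lab) :=
  {G | ∃ lam : G.V → Set S.Ty, S.ValidM G lam}

/-- The graph languages definable by shape expression schemas, single-type semantics. -/
def ShExS (Lab : Type) : Set (Set (LGraph Lab)) :=
  {L | ∃ S : Schema Lab, S.IsShEx ∧ S.Ls = L}

/-- The graph languages definable by shape expression schemas, multi-type semantics. -/
def ShExM (Lab : Type) : Set (Set (LGraph Lab)) :=
  {L | ∃ S : Schema Lab, S.IsShEx ∧ S.Lm = L}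

/-- The aggregating projection of a bag over `A₀ × ∏ i, A i` on the coordinates `0` and `i`. -/
def aggProj {ι A₀ : Type} {A : ι → Type} (i : ι) (w : Multiset (A₀ × ((j : ι) → A j))) :
    Multiset (A₀ × A i) :=
  w.map (fun p => (p.1, p.2 i))

/-- The distributing join of a family of bag languages, the `i`-th one over `A₀ × A i`. -/
def distJoin {ι A₀ : Type} {A : ι → Type} (L : (i : ι) → Set (Multiset (A₀ × A i))) :
    Set (Multiset (A₀ × ((j : ι) → A j))) :=
  {w | ∀ i : ι, aggProj i w ∈ L i}

/-- The language obtained from `L` by replacing every occurrence of each symbol `x` by the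
disjunction of the symbols in `σ x`, independently for each occurrence. -/
def replaceSym {A B : Type} (σ : A → Set B) (L : Set (Multiset A)) : Set (Multiset B) :=
  {u | ∃ w ∈ L, Multiset.Rel (fun x y => y ∈ σ x) w u}

/-- The powerset schema. Its types are the nonempty sets of types of `S`. The definition of `T` is
the distributing join of the `S.δ t`, `t ∈ T`, in which every symbol `(a, (s t)_{t ∈ T})` is
replaced by the disjunction of the `(a, T')` with `{s t | t ∈ T} ⊆ T'`. -/
def Schema.powerset {Lab : Type} (S : Schema Lab) : Schema Lab :=
  haveI := S.finTy
  { Ty := {T : Set S.Ty // T.Nonempty}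
    δ := fun T =>
      replaceSym
        (fun x : Lab × (T.1 → S.Ty) =>
          {y : Lab × {T' : Set S.Ty // T'.Nonempty} | y.1 = x.1 ∧ Set.range x.2 ⊆ y.2.1})
        (distJoin (fun t : T.1 => S.δ t.1)) }

open Classical in
/-- The fork: `0 -a→ 1`, `0 -b→ 2`, `1 -c→ 3`, `2 -c→ 4`. -/
noncomputable def fork {Lab : Type} (a b c : Lab) : LGraph Lab where
  V := Fin 5
  edges := {(0, a, 1), (0, b, 2), (1, c, 3), (2, c, 4)}

open Classical in
/-- The diamond: `0 -a→ 1`, `0 -b→ 2`, `1 -c→ 3`, `2 -c→ 3`. -/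
noncomputable def diamond {Lab : Type} (a b c : Lab) : LGraph Lab where
  V := Fin 4
  edges := {(0, a, 1), (0, b, 2), (1, c, 3), (2, c, 3)}

/-- The class `C` of graph languages separates `H` from `G`. -/
def Separates {Lab : Type} (C : Set (Set (LGraph Lab))) (H G : LGraph Lab) : Prop :=
  ∃ L ∈ C, G ∈ L ∧ H ∉ L

end ShEx

namespace ShEx

open Pointwise

/-! ### Regular bag languages and semilinear sets -/

/-! Over a finite alphabet the regular bag languages are the nonempty semilinear sets of bags.
Semilinear sets are stable under finite intersections and under images and preimages of bag
homomorphisms, hence under `distJoin` and `replaceSym`; this gives regularity of the powerset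
definitions. A valid multi-type typing is a valid single-type typing by nonempty sets: the choices
made for the types of a node combine into one tuple per edge (`Schema.Lm_eq_powerset_Ls`). Since
empty definitions are not regular, the inclusion also needs `Schema.trim`. Strictness: `ShExM`
languages cannot tell a graph from its image under a surjective cover, and the fork covers the
diamond by merging its two leaves. Single-type schemas can, because a graph read as a schema accepts
exactly the graphs with a cover onto or into it, and no cover maps the diamond to the fork. -/

theorem concat_eq_add {A : Type} (L₁ L₂ : Set (Multiset A)) : concat L₁ L₂ = L₁ + L₂ := by
  ext w
  simp only [concat, Set.mem_ofPred_eq, Set.mem_add, eq_comm]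

theorem iUnion_iter_eq_closure {A : Type} (L : Set (Multiset A)) :
    ⋃ i : ℕ, iter L i = (AddSubmonoid.closure L : Set (Multiset A)) := by
  apply Set.Subset.antisymm
  · refine Set.iUnion_subset fun i => ?_
    induction i with
    | zero => rintro _ rfl; exact zero_mem _
    | succ i ih =>
      rintro _ ⟨w₁, h₁, w₂, h₂, rfl⟩
      exact add_mem (AddSubmonoid.subset_closure h₁) (ih h₂)
  · intro w hw
    induction hw using AddSubmonoid.closure_induction_left with
    | zero => exact Set.mem_iUnion.2 ⟨0, rfl⟩
    | add_left x hx y _ ih =>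
      obtain ⟨i, hi⟩ := Set.mem_iUnion.1 ih
      exact Set.mem_iUnion.2 ⟨i + 1, x, hx, y, hi, rfl⟩

theorem IsRBE.add {A : Type} {L₁ L₂ : Set (Multiset A)} (h₁ : IsRBE L₁) (h₂ : IsRBE L₂) :
    IsRBE (L₁ + L₂) := by
  obtain ⟨E₁, rfl⟩ := h₁
  obtain ⟨E₂, rfl⟩ := h₂
  exact ⟨.conc E₁ E₂, concat_eq_add _ _⟩

theorem IsRBE.union {A : Type} {L₁ L₂ : Set (Multiset A)} (h₁ : IsRBE L₁) (h₂ : IsRBE L₂) :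
    IsRBE (L₁ ∪ L₂) := by
  obtain ⟨E₁, rfl⟩ := h₁
  obtain ⟨E₂, rfl⟩ := h₂
  exact ⟨.alt E₁ E₂, rfl⟩

theorem IsRBE.closure {A : Type} {L : Set (Multiset A)} (h : IsRBE L) :
    IsRBE (AddSubmonoid.closure L : Set (Multiset A)) := by
  obtain ⟨E, rfl⟩ := h
  exact ⟨.star E, iUnion_iter_eq_closure _⟩

theorem IsRBE.singleton {A : Type} (w : Multiset A) : IsRBE {w} := by
  induction w using Multiset.induction with
  | empty => exact ⟨.eps, rfl⟩
  | cons a w ih =>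
    have h : IsRBE ({{a}} : Set (Multiset A)) := ⟨.sym a, rfl⟩
    simpa using h.add ih

theorem IsRBE.sUnion {A : Type} {C : Set (Set (Multiset A))} (hfin : C.Finite)
    (hC : ∀ L ∈ C, IsRBE L) (hne : C.Nonempty) : IsRBE (⋃₀ C) := by
  induction C, hfin using Set.Finite.induction_on with
  | empty => exact absurd hne Set.not_nonempty_empty
  | @insert L C _ _ ih =>
    obtain rfl | hne' := C.eq_empty_or_nonempty
    · simpa using hC
    · rw [Set.sUnion_insert]
      exact (hC L (Set.mem_insert _ _)).union
        (ih (fun L' h => hC L' (Set.mem_insert_of_mem _ h)) hne')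

theorem IsRBE.of_finite {A : Type} {L : Set (Multiset A)} (hfin : L.Finite) (hne : L.Nonempty) :
    IsRBE L := by
  have h := IsRBE.sUnion (hfin.image fun w => ({w} : Set (Multiset A)))
    (by rintro _ ⟨w, _, rfl⟩; exact IsRBE.singleton w) (hne.image _)
  simpa using h

theorem IsRBE.of_isLinearSet {A : Type} {L : Set (Multiset A)} (h : IsLinearSet L) : IsRBE L := by
  obtain ⟨a, t, ht, rfl⟩ := h
  rw [← Set.singleton_vadd, vadd_eq_add]
  refine (IsRBE.singleton a).add ?_
  obtain rfl | hne := t.eq_empty_or_nonempty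
  · simpa using IsRBE.singleton (0 : Multiset A)
  · exact (IsRBE.of_finite ht hne).closure

/-- Nonemptiness is essential: no expression denotes the empty language. -/
theorem IsRBE.of_isSemilinearSet {A : Type} {L : Set (Multiset A)} (h : IsSemilinearSet L)
    (hne : L.Nonempty) : IsRBE L := by
  obtain ⟨C, hfin, hC, rfl⟩ := h
  exact IsRBE.sUnion hfin (fun t ht => IsRBE.of_isLinearSet (hC t ht)) hne.of_sUnion

theorem IsRBE.isSemilinearSet {A : Type} {L : Set (Multiset A)} (h : IsRBE L) :
    IsSemilinearSet L := by
  obtain ⟨E, rfl⟩ := h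
  induction E with
  | eps => exact .singleton _
  | sym a => exact .singleton _
  | star E ih => simpa only [RBE.lang, iUnion_iter_eq_closure] using ih.closure
  | alt E₁ E₂ ih₁ ih₂ => exact ih₁.union ih₂
  | conc E₁ E₂ ih₁ ih₂ => simpa only [RBE.lang, concat_eq_add] using ih₁.add ih₂

instance multiset_fg {A : Type} [Finite A] : AddMonoid.FG (Multiset A) := by
  refine ⟨AddSubmonoid.fg_iff _ |>.2
    ⟨Set.range fun a : A => {a}, eq_top_iff.2 fun w _ => ?_, Set.finite_range _⟩⟩
  induction w using Multiset.induction with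
  | empty => exact zero_mem _
  | cons a w ih =>
    rw [← Multiset.singleton_add]
    exact add_mem (AddSubmonoid.subset_closure ⟨a, rfl⟩) (ih trivial)

theorem isSemilinearSet_distJoin {ι A₀ : Type} {A : ι → Type} [Finite ι] [Finite A₀]
    [∀ i, Finite (A i)] {L : (i : ι) → Set (Multiset (A₀ × A i))}
    (hL : ∀ i, IsSemilinearSet (L i)) : IsSemilinearSet (distJoin L) := by
  have h : distJoin L = ⋂ i, Multiset.mapAddMonoidHom
      (fun p : A₀ × ((j : ι) → A j) => (p.1, p.2 i)) ⁻¹' L i := by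
    ext w
    simp [distJoin, aggProj]
  rw [h]
  exact .iInter fun i => (hL i).preimage _

/-- Bags of related pairs turn a relation between bags into two homomorphisms, so that `replaceSym`
becomes a preimage followed by an image. -/
theorem rel_iff_exists_map_eq {A B : Type} {r : A → B → Prop} {s : Multiset A} {t : Multiset B} :
    Multiset.Rel r s t ↔ ∃ z : Multiset {p : A × B // r p.1 p.2},
      z.map (fun p => p.1.1) = s ∧ z.map (fun p => p.1.2) = t := by
  constructor
  · intro h
    induction h with
    | zero => exact ⟨0, rfl, rfl⟩
    | cons hab _ ih =>
      obtain ⟨z, rfl, rfl⟩ := ih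
      exact ⟨⟨(_, _), hab⟩ ::ₘ z, by simp, by simp⟩
  · rintro ⟨z, rfl, rfl⟩
    exact Multiset.rel_map.2 (Multiset.rel_refl_of_refl_on fun p _ => p.2)

theorem isSemilinearSet_replaceSym {A B : Type} [Finite A] [Finite B] {σ : A → Set B}
    {L : Set (Multiset A)} (hL : IsSemilinearSet L) : IsSemilinearSet (replaceSym σ L) := by
  have h : replaceSym σ L =
      Multiset.mapAddMonoidHom (fun p : {p : A × B // p.2 ∈ σ p.1} => p.1.2) ''
        (Multiset.mapAddMonoidHom (fun p : {p : A × B // p.2 ∈ σ p.1} => p.1.1) ⁻¹' L) := by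
    ext u
    constructor
    · rintro ⟨w, hw, h⟩
      obtain ⟨z, rfl, rfl⟩ := rel_iff_exists_map_eq.1 h
      exact ⟨z, hw, rfl⟩
    · rintro ⟨z, hz, rfl⟩
      exact ⟨_, hz, rel_iff_exists_map_eq.2 ⟨z, rfl, rfl⟩⟩
  rw [h]
  exact (hL.preimage _).image _

theorem Schema.IsShEx.isSemilinearSet_powerset {Lab : Type} [Finite Lab] {S : Schema Lab}
    (hS : S.IsShEx) (T : S.powerset.Ty) : IsSemilinearSet (S.powerset.δ T) := by
  have := S.finTy
  have : Finite {T : Set S.Ty // T.Nonempty} := inferInstance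
  exact isSemilinearSet_replaceSym (B := Lab × {T : Set S.Ty // T.Nonempty})
    (isSemilinearSet_distJoin fun t => (hS t.1).isSemilinearSet)

/-! ### Multi-type typings and the powerset schema -/

theorem LGraph.map_outLabType {Lab X Y : Type} (G : LGraph Lab) (lam : G.V → X) (f : X → Y)
    (n : G.V) : (G.outLabType lam n).map (Prod.map id f) = G.outLabType (f ∘ lam) n := by
  simp [LGraph.outLabType, Multiset.map_map, Prod.map]

theorem LGraph.outLabType_eq_map {Lab X : Type} (G : LGraph Lab) (lam : G.V → X) (n : G.V) :
    G.outLabType lam n = (G.outLabType id n).map (Prod.map id lam) :=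
  (G.map_outLabType id lam n).symm

/-- A relation between bags forgets which edge received which type; this recovers a choice indexed
by the edges. The values of `d` matter only outside `s`. -/
theorem exists_eq_map_of_rel_map {I A B : Type} (d : I → B) {r : A → B → Prop} {s : Finset I}
    {f : I → A} {u : Multiset B} (h : Multiset.Rel r (s.val.map f) u) :
    ∃ g : I → B, u = s.val.map g ∧ ∀ i ∈ s, r (f i) (g i) := by
  classical
  induction s using Finset.cons_induction generalizing u with
  | empty => exact ⟨d, by simpa using h, by simp⟩
  | cons i s hi ih =>
    rw [Finset.cons_val, Multiset.map_cons, Multiset.rel_cons_left] at h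
    obtain ⟨b, u, hb, hu, rfl⟩ := h
    obtain ⟨g, rfl, hg⟩ := ih hu
    have hne : ∀ j ∈ s, j ≠ i := fun j hj h => hi (h ▸ hj)
    refine ⟨Function.update g i b, ?_, fun j hj => ?_⟩
    · rw [Finset.cons_val, Multiset.map_cons, Function.update_self]
      congr 1
      exact Multiset.map_congr rfl fun j hj => (Function.update_of_ne (hne j hj) _ _).symm
    · obtain rfl | hj := Finset.mem_cons.1 hj
      · simpa using hb
      · simpa [Function.update_of_ne (hne j hj)] using hg j hj

theorem rel_map_map_self {I A B : Type} {r : A → B → Prop} {s : Multiset I} {f : I → A}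
    {g : I → B} (h : ∀ i ∈ s, r (f i) (g i)) : Multiset.Rel r (s.map f) (s.map g) :=
  Multiset.rel_map.2 (Multiset.rel_refl_of_refl_on h)

theorem Schema.Lm_eq_powerset_Ls {Lab : Type} (S : Schema Lab) : S.Lm = S.powerset.Ls := by
  classical
  ext G
  constructor
  · rintro ⟨lam, hne, hlam⟩
    refine ⟨fun n => ⟨lam n, hne n⟩, fun n => ?_⟩
    have key : ∀ t : lam n, ∃ g : G.V × Lab × G.V → Lab × S.Ty,
        (G.edges.filter (fun e => e.1 = n)).val.map g ∈ S.δ t ∧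
        ∀ e ∈ G.edges.filter (fun e => e.1 = n), (g e).1 = e.2.1 ∧ (g e).2 ∈ lam e.2.2 := by
      intro t
      obtain ⟨u, hu, hδ⟩ := hlam n t t.2
      obtain ⟨g, rfl, hg⟩ := exists_eq_map_of_rel_map (fun e => (e.2.1, t.1)) hu
      exact ⟨g, hδ, hg⟩
    choose g hgδ hg using key
    refine ⟨(G.edges.filter (fun e => e.1 = n)).val.map fun e => (e.2.1, fun t => (g t e).2),
      fun t => ?_, rel_map_map_self fun e he => ⟨rfl, ?_⟩⟩
    · rw [aggProj, Multiset.map_map]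
      convert! hgδ t using 1
      exact Multiset.map_congr rfl fun e he => Prod.ext (hg t e he).1.symm rfl
    · rintro _ ⟨t, rfl⟩
      exact (hg t e he).2
  · rintro ⟨lam, hlam⟩
    refine ⟨fun n => (lam n).1, fun n => (lam n).2, fun n t ht => ?_⟩
    obtain ⟨w, hw, hrel⟩ := hlam n
    -- The flattening for `t` reads the `t`-component of each tuple, which lies in the set typing
    -- the target.
    refine ⟨aggProj ⟨t, ht⟩ w, ?_, hw ⟨t, ht⟩⟩
    have h : (G.outLabType lam n).map (Prod.map id Subtype.val) =
        G.outLabType (fun n => (lam n).1) n := G.map_outLabType lam Subtype.val n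
    change Multiset.Rel _ _ _
    rw [← h]
    refine Multiset.rel_map.2 ((Multiset.rel_flip.2 hrel).mono fun p _ q _ hpq => ?_)
    exact ⟨hpq.1.symm, hpq.2 ⟨⟨t, ht⟩, rfl⟩⟩

/-! ### Removing the types without realizable definitions -/

/-- Every type in `U` has a bag in its definition that uses types from `U` only. -/
def Schema.Productive {Lab : Type} (S : Schema Lab) (U : Set S.Ty) : Prop :=
  ∀ t ∈ U, ∃ w ∈ S.δ t, ∀ p ∈ w, p.2 ∈ U

/-- The restriction of a schema to its largest productive set of types. -/
def Schema.trim {Lab : Type} (S : Schema Lab) : Schema Lab :=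
  haveI := S.finTy
  { Ty := {t : S.Ty // ∃ U, S.Productive U ∧ t ∈ U}
    δ := fun t => Multiset.map (Prod.map id Subtype.val) ⁻¹' S.δ t.1 }

/-- Discarding only the types with empty definitions would not suffice: restricting the remaining
definitions could empty some of them. -/
theorem Schema.trim_δ_nonempty {Lab : Type} (S : Schema Lab) (t : S.trim.Ty) :
    (S.trim.δ t).Nonempty := by
  obtain ⟨t, U, hU, ht⟩ := t
  obtain ⟨w, hw, hwU⟩ := hU t ht
  refine ⟨w.pmap (fun p hp => (p.1, ⟨p.2, U, hU, hp⟩)) hwU, ?_⟩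
  have h : (w.pmap (fun p hp =>
      (p.1, (⟨p.2, U, hU, hp⟩ : {t : S.Ty // ∃ U, S.Productive U ∧ t ∈ U}))) hwU).map
        (Prod.map id Subtype.val) = w := by
    simp [Multiset.map_pmap, Multiset.pmap_eq_map]
  exact (congrArg (· ∈ S.δ t) h).mpr hw

theorem Schema.trim_Ls {Lab : Type} (S : Schema Lab) : S.trim.Ls = S.Ls := by
  ext G
  constructor
  · rintro ⟨lam, hlam⟩
    refine ⟨fun n => (lam n).1, fun n => ?_⟩
    have h : (G.outLabType lam n).map (Prod.map id Subtype.val) =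
        G.outLabType (fun n => (lam n).1) n := G.map_outLabType lam Subtype.val n
    exact h ▸ hlam n
  · rintro ⟨lam, hlam⟩
    -- The types used by a valid typing are productive, so none of them is trimmed.
    have hU : S.Productive (Set.range lam) := by
      rintro _ ⟨n, rfl⟩
      refine ⟨_, hlam n, fun p hp => ?_⟩
      rw [G.outLabType_eq_map] at hp
      obtain ⟨q, _, rfl⟩ := Multiset.mem_map.1 hp
      exact ⟨q.2, rfl⟩
    refine ⟨fun n => ⟨lam n, _, hU, n, rfl⟩, fun n => ?_⟩
    have h := G.map_outLabType
      (fun n => (⟨lam n, _, hU, n, rfl⟩ : {t : S.Ty // ∃ U, S.Productive U ∧ t ∈ U}))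
      Subtype.val n
    exact (congrArg (· ∈ S.δ (lam n)) h).mpr (hlam n)

theorem Schema.isShEx_trim {Lab : Type} [Finite Lab] {S : Schema Lab}
    (hS : ∀ t, IsSemilinearSet (S.δ t)) : S.trim.IsShEx := by
  intro t
  have := S.trim.finTy
  exact IsRBE.of_isSemilinearSet
    ((hS t.1).preimage (M := Multiset (Lab × S.trim.Ty))
      (Multiset.mapAddMonoidHom (Prod.map id Subtype.val))) (S.trim_δ_nonempty t)

theorem shExM_subset_shExS (Lab : Type) [Finite Lab] : ShExM Lab ⊆ ShExS Lab := by
  rintro _ ⟨S, hS, rfl⟩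
  exact ⟨S.powerset.trim, Schema.isShEx_trim hS.isSemilinearSet_powerset,
    by rw [Schema.trim_Ls, Schema.Lm_eq_powerset_Ls]⟩

/-! ### Covering maps of graphs -/

/-- A map of nodes that maps the labeled out-neighbourhood of every node to the labeled
out-neighbourhood of its image. -/
def IsCover {Lab : Type} {G H : LGraph Lab} (f : G.V → H.V) : Prop :=
  ∀ n, G.outLabType f n = H.outLabType id (f n)

theorem IsCover.outLabType_comp {Lab X : Type} {G H : LGraph Lab} {f : G.V → H.V}
    (hf : IsCover f) (lam : H.V → X) (n : G.V) :
    G.outLabType (lam ∘ f) n = H.outLabType lam (f n) := by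
  rw [H.outLabType_eq_map, ← hf n, G.outLabType_eq_map, G.outLabType_eq_map f, Multiset.map_map]
  rfl

theorem flattenings_outLabType_mono {Lab Ty : Type} {G : LGraph Lab} {lam lam' : G.V → Set Ty}
    (h : ∀ n, lam n ⊆ lam' n) (n : G.V) :
    flattenings (G.outLabType lam n) ⊆ flattenings (G.outLabType lam' n) := by
  intro u hu
  change Multiset.Rel _ _ _ at hu ⊢
  rw [G.outLabType_eq_map, Multiset.rel_map_left] at hu ⊢
  exact hu.mono fun p _ q _ hpq => ⟨hpq.1, h _ hpq.2⟩

/-- Typings of `H` pull back along `f`. Typings of `G` push forward by union over fibres, since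
enlarging the type sets only adds flattenings. -/
theorem IsCover.mem_Lm_iff {Lab : Type} {G H : LGraph Lab} {f : G.V → H.V} (hf : IsCover f)
    (hsurj : Function.Surjective f) (S : Schema Lab) : G ∈ S.Lm ↔ H ∈ S.Lm := by
  constructor
  · rintro ⟨lam, hne, hlam⟩
    refine ⟨fun m => {t | ∃ n, f n = m ∧ t ∈ lam n}, fun m => ?_, ?_⟩
    · obtain ⟨n, rfl⟩ := hsurj m
      obtain ⟨t, ht⟩ := hne n
      exact ⟨t, n, rfl, ht⟩
    · rintro _ t ⟨n, rfl, ht⟩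
      rw [← hf.outLabType_comp]
      have hsub : ∀ n, lam n ⊆ {t | ∃ n', f n' = f n ∧ t ∈ lam n'} := fun n t ht => ⟨n, rfl, ht⟩
      exact (hlam n t ht).mono
        (Set.inter_subset_inter_left _ (flattenings_outLabType_mono hsub n))
  · rintro ⟨lam, hne, hlam⟩
    refine ⟨lam ∘ f, fun n => hne _, fun n t ht => ?_⟩
    rw [hf.outLabType_comp]
    exact hlam _ t ht

theorem IsCover.not_separates {Lab : Type} {G H : LGraph Lab} {f : G.V → H.V} (hf : IsCover f)
    (hsurj : Function.Surjective f) :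
    ¬ Separates (ShExM Lab) H G ∧ ¬ Separates (ShExM Lab) G H := by
  constructor
  · rintro ⟨_, ⟨S, _, rfl⟩, h₁, h₂⟩
    exact h₂ ((hf.mem_Lm_iff hsurj S).1 h₁)
  · rintro ⟨_, ⟨S, _, rfl⟩, h₁, h₂⟩
    exact h₂ ((hf.mem_Lm_iff hsurj S).2 h₁)

/-- The schema whose types are the nodes of `G`, each defined by its out-neighbourhood in `G`. -/
def LGraph.toSchema {Lab : Type} (G : LGraph Lab) : Schema Lab :=
  haveI := G.finV
  { Ty := G.V
    δ := fun n => {G.outLabType id n} }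

theorem separates_of_forall_not_isCover {Lab : Type} {G H : LGraph Lab}
    (h : ∀ f : H.V → G.V, ¬ IsCover f) : Separates (ShExS Lab) H G :=
  ⟨G.toSchema.Ls, ⟨G.toSchema, fun _ => IsRBE.singleton _, rfl⟩, ⟨fun n : G.V => n, fun _ => rfl⟩,
    fun ⟨f, hf⟩ => h f hf⟩

/-! ### The fork and the diamond -/

/-- The typed out-neighbourhoods of the nodes of the fork. -/
def forkOut {Lab X : Type} (a b c : Lab) (lam : Fin 5 → X) : Fin 5 → Multiset (Lab × X) :=
  ![{(a, lam 1), (b, lam 2)}, {(c, lam 3)}, {(c, lam 4)}, 0, 0]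

/-- The typed out-neighbourhoods of the nodes of the diamond. -/
def diamondOut {Lab X : Type} (a b c : Lab) (lam : Fin 4 → X) : Fin 4 → Multiset (Lab × X) :=
  ![{(a, lam 1), (b, lam 2)}, {(c, lam 3)}, {(c, lam 3)}, 0]

theorem fork_outLabType {Lab X : Type} (a b c : Lab) (lam : Fin 5 → X) (n : Fin 5) :
    (fork a b c).outLabType lam n = forkOut a b c lam n := by
  classical
  have h : (fork a b c).outLabType lam n =
      (@Finset.filter (Fin 5 × Lab × Fin 5) (fun e => e.1 = n) (fun _ => Classical.propDecidable _)
        {(0, a, 1), (0, b, 2), (1, c, 3), (2, c, 4)}).val.map (fun e => (e.2.1, lam e.2.2)) := by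
    unfold LGraph.outLabType fork
    congr!
  rw [h]
  fin_cases n <;> simp [forkOut, Finset.filter_insert, Finset.filter_singleton]

theorem diamond_outLabType {Lab X : Type} (a b c : Lab) (lam : Fin 4 → X) (n : Fin 4) :
    (diamond a b c).outLabType lam n = diamondOut a b c lam n := by
  classical
  have h : (diamond a b c).outLabType lam n =
      (@Finset.filter (Fin 4 × Lab × Fin 4) (fun e => e.1 = n) (fun _ => Classical.propDecidable _)
        {(0, a, 1), (0, b, 2), (1, c, 3), (2, c, 3)}).val.map (fun e => (e.2.1, lam e.2.2)) := by
    unfold LGraph.outLabType diamond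
    congr!
  rw [h]
  fin_cases n <;> simp [diamondOut, Finset.filter_insert, Finset.filter_singleton]

theorem isCover_fork_diamond {Lab : Type} (a b c : Lab) :
    IsCover (G := fork a b c) (H := diamond a b c) (![0, 1, 2, 3, 3] : Fin 5 → Fin 4) := by
  intro n
  refine (fork_outLabType a b c _ n).trans (Eq.trans ?_ (diamond_outLabType a b c id _).symm)
  change Fin 5 at n
  fin_cases n <;> rfl

theorem not_isCover_diamond_fork {Lab : Type} (a b c : Lab)
    (f : (diamond a b c).V → (fork a b c).V) : ¬ IsCover f := by
  change Fin 4 → Fin 5 at f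
  intro hf
  have key : ∀ m : Fin 4, diamondOut a b c f m = forkOut a b c id (f m) := fun m =>
    (diamond_outLabType a b c f m).symm.trans ((hf m).trans (fork_outLabType a b c id (f m)))
  have h0 := key 0
  have h12 : forkOut a b c id (f 1) = forkOut a b c id (f 2) := (key 1).symm.trans (key 2)
  -- Only the root of the fork has two outgoing edges.
  have hf0 : f 0 = 0 := by
    have hcard := congrArg Multiset.card h0
    generalize f 0 = x at hcard ⊢
    fin_cases x <;> simp [forkOut, diamondOut] at hcard ⊢
  rw [hf0] at h0
  have hsnd : ({f 1, f 2} : Multiset (Fin 5)) = {1, 2} := by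
    simpa [forkOut, diamondOut] using congrArg (Multiset.map Prod.snd) h0
  -- If `a = b`, the two children may be swapped. Either way their out-neighbourhoods in the fork
  -- differ, contradicting `h12`.
  have hcases : ∀ x y : Fin 5, ({x, y} : Multiset (Fin 5)) = {1, 2} →
      x = 1 ∧ y = 2 ∨ x = 2 ∧ y = 1 := by decide
  obtain ⟨h1, h2⟩ | ⟨h1, h2⟩ := hcases _ _ hsnd <;> simp [h1, h2, forkOut] at h12

end ShEx

theorem mainTheorem1 (Lab : Type) [Finite Lab] :
    (∀ S : ShEx.Schema Lab, S.Lm = S.powerset.Ls) ∧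
    (∀ S : ShEx.Schema Lab, S.IsShEx →
      ∀ T : S.powerset.Ty, (S.powerset.δ T).Nonempty → ShEx.IsRBE (S.powerset.δ T)) ∧
    ShEx.ShExM Lab ⊆ ShEx.ShExS Lab ∧
    (∀ a b c : Lab,
      ShEx.Separates (ShEx.ShExS Lab) (ShEx.diamond a b c) (ShEx.fork a b c) ∧
      ¬ ShEx.Separates (ShEx.ShExM Lab) (ShEx.diamond a b c) (ShEx.fork a b c) ∧
      ¬ ShEx.Separates (ShEx.ShExM Lab) (ShEx.fork a b c) (ShEx.diamond a b c)) ∧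
    (Nonempty Lab → ShEx.ShExM Lab ⊂ ShEx.ShExS Lab) := by
  have hsep : ∀ a b c : Lab,
      ShEx.Separates (ShEx.ShExS Lab) (ShEx.diamond a b c) (ShEx.fork a b c) ∧
      ¬ ShEx.Separates (ShEx.ShExM Lab) (ShEx.diamond a b c) (ShEx.fork a b c) ∧
      ¬ ShEx.Separates (ShEx.ShExM Lab) (ShEx.fork a b c) (ShEx.diamond a b c) := by
    intro a b c
    refine ⟨ShEx.separates_of_forall_not_isCover (ShEx.not_isCover_diamond_fork a b c),
      (ShEx.isCover_fork_diamond a b c).not_separates fun m => ?_⟩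
    change Fin 4 at m
    fin_cases m
    exacts [⟨(0 : Fin 5), rfl⟩, ⟨(1 : Fin 5), rfl⟩, ⟨(2 : Fin 5), rfl⟩, ⟨(3 : Fin 5), rfl⟩]
  refine ⟨ShEx.Schema.Lm_eq_powerset_Ls, fun S hS T hT =>
    ShEx.IsRBE.of_isSemilinearSet (hS.isSemilinearSet_powerset T) hT,
    ShEx.shExM_subset_shExS Lab, hsep, fun ⟨a⟩ => ⟨ShEx.shExM_subset_shExS Lab, fun hsub => ?_⟩⟩
  -- The separation does not need distinct labels, so one label suffices.
  obtain ⟨⟨L, hL, hmem⟩, hM, -⟩ := hsep a a a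
  exact hM ⟨L, hsub hL, hmem⟩
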